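/- Let $(T_n)_{n\ge 1}$ be a random recursive tree: $T_1$ is a single vertex labelled $1$ (the root), and for $n>1$ the tree $T_n$ is obtained from $T_{n-1}$ by adding a new vertex labelled $n$ together with an edge directed from $n$ to a vertex chosen uniformly at random from $\{1,\dots,n-1\}$, the choices being independent for different $n$. The degree of a vertex is the number of edges directed towards it. Let $D=D(n)$ be the degree of the root in $T_n$, and let $Z_{\ge D}=Z_{\ge D}(n)$ be the number of vertices of $T_n$ whose degree in $T_n$ is at least $D$. Put $\gamma:=1-\ln 2$. Then for every positive integer $k$, as $n\to\infty$, $$\mathbb{E}\big[(\ln Z_{\ge D})^k\big]=(\gamma\ln n)^k\,(1+o(1)).$$ -/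

import Mathlib

open MeasureTheory ProbabilityTheory Filter Asymptotics

/-- `parent` describes the growth of a random recursive tree on the probability space `(Ω, P)`:
`parent i` is the random label of the vertex to which the vertex labelled `i` is attached. The tree
starts from the root, labelled `1`, and each later vertex `i = 2, 3, …` is attached to a uniformly
chosen vertex of `{1, …, i - 1}`, all the choices being independent. (`parent 0` and `parent 1`
play no role.) -/
structure IsRandomRecursiveTree {Ω : Type*} [MeasurableSpace Ω] (P : Measure Ω)
    (parent : ℕ → Ω → ℕ) : Prop where
  uniform : ∀ i, 2 ≤ i → HasLaw (parent i) (uniformOn (Set.Icc 1 (i - 1))) P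
  indep : iIndepFun (fun (i : {i : ℕ // 2 ≤ i}) => parent i) P

/-- In the tree of size `n`, with vertex set `{1, …, n}` and an edge directed from `j` to `par j` for
every `j ∈ {2, …, n}`: the degree of `v` is the number of edges directed towards `v`. -/
def treeDegree (par : ℕ → ℕ) (n v : ℕ) : ℕ :=
  ((Finset.Icc 2 n).filter (fun j => par j = v)).card

/-- The degree `D` of the root of the tree of size `n`. -/
def rootDegree (par : ℕ → ℕ) (n : ℕ) : ℕ := treeDegree par n 1

/-- `Z_{≥ d}`: the number of vertices of degree at least `d` in the tree of size `n`. -/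
def tailCount (par : ℕ → ℕ) (n d : ℕ) : ℕ :=
  ((Finset.Icc 1 n).filter (fun v => d ≤ treeDegree par n v)).card

/-- Random recursive trees exist. -/
theorem exists_isRandomRecursiveTree :
    ∃ (P : Measure (ℕ → ℕ)) (_ : IsProbabilityMeasure P),
      IsRandomRecursiveTree P (fun i ω => ω i) := by
  let ν : ℕ → Measure ℕ := fun i => uniformOn (Set.Icc 1 (max 1 (i - 1)))
  have hν : ∀ i, IsProbabilityMeasure (ν i) := fun i =>
    isProbabilityMeasure_uniformOn (Set.finite_Icc _ _) ⟨1, by simp⟩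
  refine ⟨Measure.infinitePi ν, inferInstance, ?_, ?_⟩
  · intro i hi
    have h : max 1 (i - 1) = i - 1 := by omega
    have h2 := Measure.infinitePi_map_eval ν i
    refine ⟨(measurable_pi_apply i).aemeasurable, ?_⟩
    simpa [ν, h, Function.eval] using h2
  · have h := iIndepFun_infinitePi (P := ν) (X := fun _ x => x) (fun _ => measurable_id)
    exact h.precomp Subtype.val_injective

/-! Write `L = log n`. The root degree is a sum of independent indicators with mean about `L`, so by
Chernoff bounds it lies in `((1 - ε)L, (1 + ε)L)` with high probability. Since `Z_{≥ d}` decreases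
in `d`, `Z_{≥ D}` is then sandwiched between its values at two deterministic levels near `L`; the
dependence between `D` and the other degrees never matters. It remains to see that `Z_{≥ d}` is `n ^
(1 - log 2 + O(ε))` at such levels.

Upper bound: the degree `X` of vertex `v` satisfies `E 2^X = n / v`, because the product telescopes.
Markov's inequality, summed over `v`, gives `E Z_{≥ d} ≤ n (1 + L) / 2^d` (behind
`UniformChoices.measureReal_le_hitsTail`).

Lower bound: keep only the first `a + 1` vertices and the edges arriving after they are all present,
with `a` about `n ^ (1/2 - 2ε)`. Weighting by `2^X` doubles the typical degree to `2 log (n / a)`,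
about `(1 + 4ε)L`. Hence the values of `X` between `d` and `e`, about `(1 + 7ε)L`, carry at least
half of `E 2^X`, and `P(X ≥ d) ≥ n / (2 (a + 1) 2^e)` (`UniformChoices.le_measureReal_hits`).
Degrees are pairwise negatively correlated (`measureReal_hits_and_le`), so Chebyshev's inequality
turns the mean into a bound with high probability.

Thus `log Z_{≥ D} / L` tends to `1 - log 2` in probability. As `1 ≤ Z_{≥ D} ≤ n`, this ratio stays
in `[0, 1]`, so its moments converge too. -/

/-- The number of indices in `s` whose choice is `v`. -/
def hits {Ω : Type*} (Y : ℕ → Ω → ℕ) (s : Finset ℕ) (v : ℕ) (ω : Ω) : ℕ :=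
  (s.filter (fun i => Y i ω = v)).card

lemma hits_le_card {Ω : Type*} (Y : ℕ → Ω → ℕ) (s : Finset ℕ) (v : ℕ) (ω : Ω) : hits Y s v ω ≤ s.card :=
  Finset.card_filter_le _ _

lemma hits_insert {Ω : Type*} {Y : ℕ → Ω → ℕ} {s : Finset ℕ} {i : ℕ} (hi : i ∉ s) (v : ℕ) (ω : Ω) :
    hits Y (insert i s) v ω = hits Y s v ω + if Y i ω = v then 1 else 0 := by
  unfold hits
  rw [Finset.filter_insert]
  split_ifs with h
  · rw [Finset.card_insert_of_notMem (by simp [hi])]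
  · simp

/-! ### Independent choices: generating function and negative correlation. -/

section Independent

variable {Ω : Type*} [MeasurableSpace Ω] {P : Measure Ω} [IsProbabilityMeasure P] {Y : ℕ → Ω → ℕ}

lemma measurable_hits (hm : ∀ i, Measurable (Y i)) (s : Finset ℕ) (v : ℕ) :
    Measurable (hits Y s v) := by
  have : hits Y s v = fun ω => ∑ i ∈ s, if Y i ω = v then 1 else 0 := by
    ext ω; exact Finset.card_filter _ _
  rw [this]
  refine Finset.measurable_sum _ fun i _ => ?_
  exact Measurable.ite (hm i (measurableSet_singleton v)) measurable_const measurable_const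

lemma integral_pow_hits (hm : ∀ i, Measurable (Y i)) (hY : iIndepFun Y P) (s : Finset ℕ) (v : ℕ)
    (z : ℝ) :
    ∫ ω, z ^ hits Y s v ω ∂P = ∏ i ∈ s, (1 + (z - 1) * P.real {ω | Y i ω = v}) := by
  have h1 : ∀ ω, z ^ hits Y s v ω = ∏ i : s, (fun x : ℕ => if x = v then z else 1) (Y i ω) := by
    intro ω
    rw [Finset.prod_coe_sort s (fun i => if Y i ω = v then z else 1), ← Finset.prod_filter,
      Finset.prod_const, hits]
  simp_rw [h1]
  have h2 := (hY.precomp (g := ((↑) : s → ℕ)) Subtype.val_injective).integral_fun_prod_comp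
    (f := fun _ (x : ℕ) => if x = v then z else 1) (fun i => (hm i).aemeasurable)
    (fun i => (measurable_of_countable _).aestronglyMeasurable)
  rw [h2, Finset.prod_coe_sort s (fun i => ∫ ω, (if Y i ω = v then z else 1) ∂P)]
  refine Finset.prod_congr rfl fun i _ => ?_
  have h3 : ∀ ω, (if Y i ω = v then z else (1 : ℝ)) =
      1 + Set.indicator {ω | Y i ω = v} (fun _ => z - 1) ω := by
    intro ω
    by_cases h : Y i ω = v <;> simp [h]
  have hS : MeasurableSet {ω | Y i ω = v} := hm i (measurableSet_singleton v)
  simp_rw [h3]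
  rw [integral_add (integrable_const _) ((integrable_const _).indicator hS),
    integral_indicator_const _ hS]
  simp [mul_comm]

lemma integrable_pow_hits (hm : ∀ i, Measurable (Y i)) (s : Finset ℕ) (v : ℕ) (z : ℝ) :
    Integrable (fun ω => z ^ hits Y s v ω) P := by
  refine Integrable.of_bound (C := (max 1 |z|) ^ s.card)
    ((measurable_of_countable (fun x : ℕ => z ^ x)).comp
      (measurable_hits hm s v)).aestronglyMeasurable (ae_of_all _ fun ω => ?_)
  rw [Real.norm_eq_abs, abs_pow]
  calc |z| ^ hits Y s v ω ≤ (max 1 |z|) ^ hits Y s v ω := by gcongr; exact le_max_right _ _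
    _ ≤ _ := pow_le_pow_right₀ (le_max_left _ _) (hits_le_card _ _ _ _)

/-- Conditioning on the new choice, which is `u`, `v` or neither. Truncated subtraction is right at
level `0`, where the condition is void. -/
lemma measureReal_hits_insert (hm : ∀ i, Measurable (Y i)) (hY : iIndepFun Y P) {s : Finset ℕ}
    {i : ℕ} (hi : i ∉ s) {u v : ℕ} (huv : u ≠ v) (a b : ℕ) :
    P.real {ω | a ≤ hits Y (insert i s) u ω ∧ b ≤ hits Y (insert i s) v ω} =
      P.real {ω | Y i ω = u} * P.real {ω | a - 1 ≤ hits Y s u ω ∧ b ≤ hits Y s v ω} +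
      P.real {ω | Y i ω = v} * P.real {ω | a ≤ hits Y s u ω ∧ b - 1 ≤ hits Y s v ω} +
      (1 - P.real {ω | Y i ω = u} - P.real {ω | Y i ω = v}) *
        P.real {ω | a ≤ hits Y s u ω ∧ b ≤ hits Y s v ω} := by
  have hind : IndepFun (fun ω => (hits Y s u ω, hits Y s v ω)) (Y i) P := by
    have h := hY.indepFun_finset s {i} (by simpa using hi) hm
    have := h.comp (φ := fun y : s → ℕ => ((Finset.univ.filter (fun j => y j = u)).card,
      (Finset.univ.filter (fun j => y j = v)).card))
      (ψ := fun y : ({i} : Finset ℕ) → ℕ => y ⟨i, by simp⟩) (measurable_of_countable _)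
      (measurable_of_countable _)
    convert this using 1
    ext ω
    · simp only [Function.comp, hits]
      rw [Finset.card_filter, Finset.card_filter, Finset.sum_coe_sort s
        (fun j => if Y j ω = u then 1 else 0)]
    · simp only [Function.comp, hits]
      rw [Finset.card_filter, Finset.card_filter, Finset.sum_coe_sort s
        (fun j => if Y j ω = v then 1 else 0)]
    · rfl
  have key : ∀ (a b : ℕ) (B : Set ℕ),
      P.real ({ω | a ≤ hits Y s u ω ∧ b ≤ hits Y s v ω} ∩ Y i ⁻¹' B) =
      P.real (Y i ⁻¹' B) * P.real {ω | a ≤ hits Y s u ω ∧ b ≤ hits Y s v ω} := by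
    intro a b B
    have := hind.measure_inter_preimage_eq_mul (s := {x : ℕ × ℕ | a ≤ x.1 ∧ b ≤ x.2})
      (t := B) (.of_discrete) (.of_discrete)
    simp only [Measure.real]
    rw [mul_comm, ← ENNReal.toReal_mul]
    exact congrArg _ this
  have mu : MeasurableSet (Y i ⁻¹' {u}) := hm i (measurableSet_singleton u)
  have mv : MeasurableSet (Y i ⁻¹' {v}) := hm i (measurableSet_singleton v)
  rw [← measureReal_inter_add_sdiff (s := {ω | a ≤ hits Y (insert i s) u ω ∧
    b ≤ hits Y (insert i s) v ω}) mu,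
    ← measureReal_inter_add_sdiff (s := {ω | a ≤ hits Y (insert i s) u ω ∧
    b ≤ hits Y (insert i s) v ω} \ Y i ⁻¹' {u}) mv, ← add_assoc]
  have e1 : {ω | a ≤ hits Y (insert i s) u ω ∧ b ≤ hits Y (insert i s) v ω} ∩ Y i ⁻¹' {u} =
      {ω | a - 1 ≤ hits Y s u ω ∧ b ≤ hits Y s v ω} ∩ Y i ⁻¹' {u} := by
    ext ω
    simp only [Set.mem_inter_iff, Set.mem_ofPred_eq, Set.mem_preimage, Set.mem_singleton_iff,
      hits_insert hi]
    grind
  have e2 : ({ω | a ≤ hits Y (insert i s) u ω ∧ b ≤ hits Y (insert i s) v ω} \ Y i ⁻¹' {u}) ∩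
      Y i ⁻¹' {v} = {ω | a ≤ hits Y s u ω ∧ b - 1 ≤ hits Y s v ω} ∩ Y i ⁻¹' {v} := by
    ext ω
    simp only [Set.mem_inter_iff, Set.mem_sdiff, Set.mem_ofPred_eq, Set.mem_preimage,
      Set.mem_singleton_iff, hits_insert hi]
    grind
  have e3 : ({ω | a ≤ hits Y (insert i s) u ω ∧ b ≤ hits Y (insert i s) v ω} \ Y i ⁻¹' {u}) \
      Y i ⁻¹' {v} = {ω | a ≤ hits Y s u ω ∧ b ≤ hits Y s v ω} ∩ Y i ⁻¹' ({u, v}ᶜ) := by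
    ext ω
    simp only [Set.mem_inter_iff, Set.mem_sdiff, Set.mem_ofPred_eq, Set.mem_preimage,
      Set.mem_singleton_iff, hits_insert hi, Set.mem_compl_iff, Set.mem_insert_iff]
    grind
  rw [e1, e2, e3, key, key, key]
  have e4 : P.real (Y i ⁻¹' {u, v}ᶜ) = 1 - P.real {ω | Y i ω = u} - P.real {ω | Y i ω = v} := by
    have hd : Disjoint (Y i ⁻¹' {u}) (Y i ⁻¹' {v}) :=
      Disjoint.preimage _ (by simpa using huv)
    rw [Set.preimage_compl, measureReal_compl (hm i .of_discrete),
      show ({u, v} : Set ℕ) = {u} ∪ {v} from rfl, Set.preimage_union,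
      measureReal_union hd mv]
    simp only [probReal_univ]
    change 1 - (P.real {ω | Y i ω = u} + P.real {ω | Y i ω = v}) = _
    ring
  rw [e4]
  rfl

/-- The numbers of choices of two distinct vertices are negatively correlated. -/
lemma measureReal_hits_and_le (hm : ∀ i, Measurable (Y i)) (hY : iIndepFun Y P) {u v : ℕ}
    (huv : u ≠ v) (s : Finset ℕ) (a b : ℕ) :
    P.real {ω | a ≤ hits Y s u ω ∧ b ≤ hits Y s v ω} ≤
      P.real {ω | a ≤ hits Y s u ω} * P.real {ω | b ≤ hits Y s v ω} := by
  induction s using Finset.induction_on generalizing a b with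
  | empty =>
    by_cases ha : a = 0 <;> by_cases hb : b = 0 <;> simp [hits, ha, hb]
  | insert i s hi ih =>
    have h1 := measureReal_hits_insert (P := P) hm hY hi huv a b
    -- Level `0` for one vertex turns the joint recursion into the recursion for the other vertex
    -- alone.
    have h2 := measureReal_hits_insert (P := P) hm hY hi huv a 0
    have h3 := measureReal_hits_insert (P := P) hm hY hi huv 0 b
    simp only [zero_le, and_true, true_and, zero_tsub] at h2 h3
    rw [h1, h2, h3]
    have i1 := ih (a - 1) b
    have i2 := ih a (b - 1)
    have i3 := ih a b
    have hF : P.real {ω | a ≤ hits Y s u ω} ≤ P.real {ω | a - 1 ≤ hits Y s u ω} :=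
      measureReal_mono fun ω h => le_trans (Nat.sub_le _ _) h
    have hG : P.real {ω | b ≤ hits Y s v ω} ≤ P.real {ω | b - 1 ≤ hits Y s v ω} :=
      measureReal_mono fun ω h => le_trans (Nat.sub_le _ _) h
    have hpq : P.real {ω | Y i ω = u} + P.real {ω | Y i ω = v} ≤ 1 := by
      have hd : Disjoint {ω | Y i ω = u} {ω | Y i ω = v} :=
        Disjoint.preimage (Y i) (s := {u}) (t := {v}) (by simpa using huv)
      rw [← measureReal_union hd (hm i (measurableSet_singleton v))]
      exact measureReal_le_one
    have hp : 0 ≤ P.real {ω | Y i ω = u} := measureReal_nonneg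
    have hq : 0 ≤ P.real {ω | Y i ω = v} := measureReal_nonneg
    generalize P.real {ω | Y i ω = u} = p at *
    generalize P.real {ω | Y i ω = v} = q at *
    generalize P.real {ω | a ≤ hits Y s u ω} = F at *
    generalize P.real {ω | b ≤ hits Y s v ω} = G at *
    generalize P.real {ω | a - 1 ≤ hits Y s u ω} = F' at *
    generalize P.real {ω | b - 1 ≤ hits Y s v ω} = G' at *
    have j1 := mul_le_mul_of_nonneg_left i1 hp
    have j2 := mul_le_mul_of_nonneg_left i2 hq
    have j3 := mul_le_mul_of_nonneg_left i3 (show 0 ≤ 1 - p - q by linarith)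
    -- This is exactly `(pF' + (1-p)F)(qG' + (1-q)G)` minus `pF'G + qFG' + (1-p-q)FG`: one choice
    -- cannot hit both vertices, so the term in `pq` is lost.
    have j4 : 0 ≤ p * q * ((F' - F) * (G' - G)) :=
      mul_nonneg (mul_nonneg hp hq) (mul_nonneg (by linarith) (by linarith))
    linear_combination j1 + j2 + j3 + j4

end Independent

/-! ### First and second moment bounds for the number of events that occur. -/

section Counting

variable {Ω : Type*} [MeasurableSpace Ω] {P : Measure Ω} [IsProbabilityMeasure P]

/-- Markov's inequality for the number of events that occur. -/
lemma measureReal_le_card_filter_le {ι : Type*} (t : Finset ι) (A : ι → Set Ω)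
    [∀ i ω, Decidable (ω ∈ A i)]
    (hA : ∀ i ∈ t, MeasurableSet (A i)) {x : ℝ} (hx : 0 < x) :
    P.real {ω | x ≤ ((t.filter (fun i => ω ∈ A i)).card : ℝ)} ≤ (∑ i ∈ t, P.real (A i)) / x := by
  have h1 : ∀ ω, ((t.filter (fun i => ω ∈ A i)).card : ℝ) =
      ∑ i ∈ t, (A i).indicator (fun _ => (1 : ℝ)) ω := by
    intro ω; simp [Set.indicator_apply]
  have hint : ∀ i ∈ t, Integrable ((A i).indicator (fun _ => (1 : ℝ))) P :=
    fun i hi => (integrable_const _).indicator (hA i hi)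
  have h2 := mul_meas_ge_le_integral_of_nonneg (μ := P)
    (f := fun ω => ∑ i ∈ t, (A i).indicator (fun _ => (1 : ℝ)) ω)
    (ae_of_all _ fun ω => Finset.sum_nonneg fun i _ => Set.indicator_nonneg (by simp) _)
    (integrable_finsetSum _ hint) x
  rw [integral_finsetSum _ hint] at h2
  rw [le_div_iff₀ hx, mul_comm]
  simp_rw [h1]
  refine h2.trans (le_of_eq (Finset.sum_congr rfl fun i hi => ?_))
  rw [integral_indicator_const _ (hA i hi)]
  simp

/-- Chebyshev's inequality for the number of events that occur, for pairwise negatively correlated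
events. -/
lemma measureReal_card_filter_le_half {ι : Type*} (t : Finset ι) (A : ι → Set Ω)
    [∀ i ω, Decidable (ω ∈ A i)]
    (hA : ∀ i ∈ t, MeasurableSet (A i))
    (hcorr : ∀ i ∈ t, ∀ j ∈ t, i ≠ j → P.real (A i ∩ A j) ≤ P.real (A i) * P.real (A j))
    (hpos : 0 < ∑ i ∈ t, P.real (A i)) :
    P.real {ω | ((t.filter (fun i => ω ∈ A i)).card : ℝ) ≤ (∑ i ∈ t, P.real (A i)) / 2} ≤
      4 / ∑ i ∈ t, P.real (A i) := by
  classical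
  set μ := ∑ i ∈ t, P.real (A i)
  let N : Ω → ℝ := fun ω => ∑ i ∈ t, (A i).indicator (fun _ => (1 : ℝ)) ω
  have h1 : ∀ ω, ((t.filter (fun i => ω ∈ A i)).card : ℝ) = N ω := by
    intro ω; simp [N, Set.indicator_apply]
  have hint : ∀ i ∈ t, Integrable ((A i).indicator (fun _ => (1 : ℝ))) P :=
    fun i hi => (integrable_const _).indicator (hA i hi)
  have hN : Integrable N P := integrable_finsetSum _ hint
  have hEN : ∫ ω, N ω ∂P = μ := by
    rw [integral_finsetSum _ hint]
    refine Finset.sum_congr rfl fun i hi => ?_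
    rw [integral_indicator_const _ (hA i hi)]; simp
  have hsq : ∀ ω, N ω ^ 2 = ∑ i ∈ t, ∑ j ∈ t, (A i ∩ A j).indicator (fun _ => (1 : ℝ)) ω := by
    intro ω
    rw [sq, Finset.sum_mul_sum]
    refine Finset.sum_congr rfl fun i _ => Finset.sum_congr rfl fun j _ => ?_
    by_cases hi : ω ∈ A i <;> by_cases hj : ω ∈ A j <;> simp [hi, hj]
  have hint2 : ∀ i ∈ t, ∀ j ∈ t, Integrable ((A i ∩ A j).indicator (fun _ => (1 : ℝ))) P :=
    fun i hi j hj => (integrable_const _).indicator ((hA i hi).inter (hA j hj))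
  have hN2 : Integrable (fun ω => N ω ^ 2) P := by
    simp_rw [hsq]
    exact integrable_finsetSum _ fun i hi => integrable_finsetSum _ (hint2 i hi)
  have hEN2 : ∫ ω, N ω ^ 2 ∂P ≤ μ + μ ^ 2 := by
    simp_rw [hsq]
    rw [integral_finsetSum _ fun i hi => integrable_finsetSum _ (hint2 i hi)]
    have : μ + μ ^ 2 = ∑ i ∈ t, (P.real (A i) + P.real (A i) * μ) := by
      rw [Finset.sum_add_distrib, ← Finset.sum_mul, sq]
    rw [this]
    refine Finset.sum_le_sum fun i hi => ?_
    rw [integral_finsetSum _ (hint2 i hi)]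
    have : ∀ j ∈ t, ∫ ω, (A i ∩ A j).indicator (fun _ => (1 : ℝ)) ω ∂P ≤
        (if j = i then P.real (A i) else 0) + P.real (A i) * P.real (A j) := by
      intro j hj
      rw [integral_indicator_const _ ((hA i hi).inter (hA j hj))]
      simp only [smul_eq_mul, mul_one]
      split_ifs with h
      · subst h
        simp [mul_self_nonneg]
      · simpa using hcorr i hi j hj (Ne.symm h)
    refine (Finset.sum_le_sum this).trans ?_
    rw [Finset.sum_add_distrib, ← Finset.mul_sum, Finset.sum_ite_eq' t i, if_pos hi]
  have hvar : ∫ ω, (N ω - μ) ^ 2 ∂P ≤ μ := by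
    have : ∀ ω, (N ω - μ) ^ 2 = N ω ^ 2 - 2 * μ * N ω + μ ^ 2 := fun ω => by ring
    simp_rw [this]
    rw [integral_add (f := fun ω => N ω ^ 2 - 2 * μ * N ω) (hN2.sub (hN.const_mul _))
      (integrable_const _),
      integral_sub hN2 (hN.const_mul _), integral_const_mul, hEN]
    simp only [integral_const, probReal_univ, smul_eq_mul, one_mul]
    linarith
  have hint3 : Integrable (fun ω => (N ω - μ) ^ 2) P := by
    have : ∀ ω, (N ω - μ) ^ 2 = N ω ^ 2 - 2 * μ * N ω + μ ^ 2 := fun ω => by ring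
    simp_rw [this]
    exact (hN2.sub (hN.const_mul _)).add (integrable_const _)
  have hmk := mul_meas_ge_le_integral_of_nonneg (μ := P) (f := fun ω => (N ω - μ) ^ 2)
    (ae_of_all _ fun ω => sq_nonneg _) hint3 (μ ^ 2 / 4)
  have hsub : P.real {ω | ((t.filter (fun i => ω ∈ A i)).card : ℝ) ≤ μ / 2} ≤
      P.real {ω | μ ^ 2 / 4 ≤ (N ω - μ) ^ 2} := by
    refine measureReal_mono fun ω hω => ?_
    simp only [Set.mem_ofPred_eq, h1] at hω ⊢
    nlinarith
  refine hsub.trans ?_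
  rw [le_div_iff₀ hpos]
  have := hmk.trans hvar
  have h4 : μ ^ 2 / 4 * P.real {ω | μ ^ 2 / 4 ≤ (N ω - μ) ^ 2} =
    μ / 4 * (P.real {ω | μ ^ 2 / 4 ≤ (N ω - μ) ^ 2} * μ) := by ring
  change μ ^ 2 / 4 * P.real {ω | μ ^ 2 / 4 ≤ (N ω - μ) ^ 2} ≤ μ at this
  rw [h4] at this
  nlinarith

end Counting

/-- The variables `Y 0, Y 1, …` are independent and `Y i` is uniform on `{1, …, i + 1}`. -/
structure UniformChoices {Ω : Type*} [MeasurableSpace Ω] (P : Measure Ω) (Y : ℕ → Ω → ℕ) :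
    Prop where
  measurable : ∀ i, Measurable (Y i)
  indep : iIndepFun Y P
  prob : ∀ i v, 1 ≤ v → v ≤ i + 1 → P.real {ω | Y i ω = v} = 1 / (i + 1)
  le : ∀ i, ∀ᵐ ω ∂P, Y i ω ≤ i + 1

/-! ### Elementary estimates for products, sums and exponentials. -/

section Sums

lemma prod_Ico_one_add_inv {a b : ℕ} (hab : a ≤ b) :
    ∏ i ∈ Finset.Ico a b, (1 + 1 / ((i : ℝ) + 1)) = (b + 1) / (a + 1) := by
  induction b, hab using Nat.le_induction with
  | base => simp [div_self (show (a : ℝ) + 1 ≠ 0 by positivity)]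
  | succ b hab ih =>
    rw [Finset.prod_Ico_succ_top hab, ih]
    push_cast
    field_simp

lemma log_div_le_sum_Ico {a b : ℕ} (hab : a ≤ b) :
    Real.log ((b + 2) / (a + 2)) ≤ ∑ i ∈ Finset.Ico a b, 1 / ((i : ℝ) + 2) := by
  induction b, hab using Nat.le_induction with
  | base => simp [div_self (show (a : ℝ) + 2 ≠ 0 by positivity)]
  | succ b hab ih =>
    rw [Finset.sum_Ico_succ_top hab]
    have h : (((b + 1 : ℕ) : ℝ) + 2) / (a + 2) = (b + 2) / (a + 2) * (1 + 1 / (b + 2)) := by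
      push_cast; field_simp; ring
    rw [h, Real.log_mul (by positivity) (by positivity)]
    have := Real.log_le_sub_one_of_pos (show (0 : ℝ) < 1 + 1 / (b + 2) by positivity)
    linarith

lemma sum_Ico_le_log_div {a b : ℕ} (hab : a ≤ b) :
    ∑ i ∈ Finset.Ico a b, 1 / ((i : ℝ) + 2) ≤ Real.log ((b + 1) / (a + 1)) := by
  induction b, hab using Nat.le_induction with
  | base => simp [div_self (show (a : ℝ) + 1 ≠ 0 by positivity)]
  | succ b hab ih =>
    rw [Finset.sum_Ico_succ_top hab]
    have h : (((b + 1 : ℕ) : ℝ) + 1) / (a + 1) = (b + 1) / (a + 1) * ((b + 2) / (b + 1)) := by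
      push_cast; field_simp; ring
    rw [h, Real.log_mul (by positivity) (by positivity)]
    have := Real.one_sub_inv_le_log_of_pos (show (0 : ℝ) < (b + 2) / (b + 1) by positivity)
    have h2 : 1 - (((b : ℝ) + 2) / (b + 1))⁻¹ = 1 / (b + 2) := by field_simp; ring
    linarith

lemma sum_range_inv_eq_harmonic (b : ℕ) :
    ∑ i ∈ Finset.Ico 0 b, 1 / ((i : ℝ) + 1) = harmonic b := by
  simp [harmonic]

/-- The generating function at `z` is compared with its value at `2`: each factor `(i + z)/(i + 1)`
is `(i + 2)/(i + 1)` times `(i + z)/(i + 2)`. The second is the generating function, at `z / 2`, of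
an indicator of mean `2/(i + 2)`, the law tilted by `2^X`. -/
lemma prod_Ico_le_exp {a b : ℕ} (hab : a ≤ b) {z : ℝ} (hz : 0 ≤ z) :
    ∏ i ∈ Finset.Ico a b, (1 + (z - 1) * (1 / ((i : ℝ) + 1))) ≤
      (b + 1) / (a + 1) * Real.exp ((z - 2) * ∑ i ∈ Finset.Ico a b, 1 / ((i : ℝ) + 2)) := by
  rw [← prod_Ico_one_add_inv hab, Finset.mul_sum, Real.exp_sum, ← Finset.prod_mul_distrib]
  refine Finset.prod_le_prod (fun i _ => ?_) fun i _ => ?_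
  · have : 1 + (z - 1) * (1 / ((i : ℝ) + 1)) = (i + z) / (i + 1) := by field_simp; ring
    rw [this]; positivity
  · have : 1 + (z - 1) * (1 / ((i : ℝ) + 1)) =
        (1 + 1 / ((i : ℝ) + 1)) * (1 + (z - 2) * (1 / ((i : ℝ) + 2))) := by field_simp; ring
    rw [this]
    gcongr
    linarith [Real.add_one_le_exp ((z - 2) * (1 / ((i : ℝ) + 2)))]

lemma exp_neg_div_le_one_sub {t : ℝ} (ht : t < 1) : Real.exp (-(t / (1 - t))) ≤ 1 - t := by
  have h1 : 0 < 1 - t := by linarith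
  have h2 := Real.add_one_le_exp (t / (1 - t))
  rw [Real.exp_neg, inv_le_comm₀ (Real.exp_pos _) h1]
  refine le_trans (le_of_eq ?_) h2
  field_simp; ring

lemma exp_div_le_one_add {t : ℝ} (ht : 0 ≤ t) : Real.exp (t / (1 + t)) ≤ 1 + t := by
  have h1 : 0 < 1 + t := by linarith
  have h2 := Real.add_one_le_exp (-(t / (1 + t)))
  rw [Real.exp_neg] at h2
  rw [← inv_le_inv₀ h1 (Real.exp_pos _)]
  refine le_trans (le_of_eq ?_) h2
  field_simp; ring

/-- The three terms cover the middle range, `x < d` and `x > e`; the outer two are Chernoff bounds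
under the tilted law, with bases `y` and `w` on either side of `2`. -/
lemma two_pow_le_tilt {y w : ℝ} (hy : 0 < y) (hy2 : y ≤ 2) (hw : 2 ≤ w) (d e x : ℕ) :
    (2 : ℝ) ^ x ≤ 2 ^ e * (if d ≤ x then 1 else 0) + (2 / y) ^ d * y ^ x + (2 / w) ^ e * w ^ x := by
  have h0 : 0 < w := by linarith
  have p1 : 0 ≤ (2 / y) ^ d * y ^ x := by positivity
  have p2 : 0 ≤ (2 / w) ^ e * w ^ x := by positivity
  have p3 : (0 : ℝ) ≤ 2 ^ e * (if d ≤ x then 1 else 0) := by positivity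
  rcases lt_or_ge x d with h | h
  · have : (2 : ℝ) ^ x = (2 / y) ^ x * y ^ x := by rw [← mul_pow]; congr 1; field_simp
    have h3 : (2 / y) ^ x ≤ (2 / y) ^ d :=
      pow_le_pow_right₀ (by rw [le_div_iff₀ hy]; linarith) h.le
    have := mul_le_mul_of_nonneg_right h3 (show 0 ≤ y ^ x by positivity)
    linarith
  · rcases le_or_gt x e with h' | h'
    · rw [if_pos h]
      have : (2 : ℝ) ^ x ≤ 2 ^ e := pow_le_pow_right₀ (by norm_num) h'
      linarith
    · have : (2 : ℝ) ^ x = (2 / w) ^ x * w ^ x := by rw [← mul_pow]; congr 1; field_simp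
      have h3 : (2 / w) ^ x ≤ (2 / w) ^ e :=
        pow_le_pow_of_le_one (by positivity) (by rw [div_le_iff₀ h0]; linarith) h'.le
      have := mul_le_mul_of_nonneg_right h3 (show 0 ≤ w ^ x by positivity)
      linarith

end Sums

/-! ### Tail bounds for the degree of one vertex. -/

section Degrees

variable {Ω : Type*} [MeasurableSpace Ω] {P : Measure Ω} [IsProbabilityMeasure P]

lemma measureReal_le_integral_div {f : Ω → ℝ} (hf : Integrable f P) (h0 : ∀ ω, 0 ≤ f ω) {c : ℝ}
    (hc : 0 < c) {s : Set Ω} (hs : ∀ ω ∈ s, c ≤ f ω) : P.real s ≤ (∫ ω, f ω ∂P) / c := by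
  rw [le_div_iff₀ hc, mul_comm]
  refine le_trans ?_ (mul_meas_ge_le_integral_of_nonneg (ae_of_all _ h0) hf c)
  gcongr
  · exact measure_ne_top _ _
  · exact hs

variable {Y : ℕ → Ω → ℕ}

lemma UniformChoices.integral_pow_hits (hY : UniformChoices P Y) {a v : ℕ} (hv : 1 ≤ v)
    (hva : v ≤ a + 1) (b : ℕ) (z : ℝ) :
    ∫ ω, z ^ hits Y (Finset.Ico a b) v ω ∂P =
      ∏ i ∈ Finset.Ico a b, (1 + (z - 1) * (1 / ((i : ℝ) + 1))) := by
  rw [_root_.integral_pow_hits hY.measurable hY.indep]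
  refine Finset.prod_congr rfl fun i hi => ?_
  rw [hY.prob i v hv]
  have := (Finset.mem_Ico.1 hi).1
  omega

lemma UniformChoices.integral_two_pow_hits (hY : UniformChoices P Y) {a v : ℕ} (hv : 1 ≤ v)
    (hva : v ≤ a + 1) {b : ℕ} (hab : a ≤ b) :
    ∫ ω, (2 : ℝ) ^ hits Y (Finset.Ico a b) v ω ∂P = (b + 1) / (a + 1) := by
  rw [hY.integral_pow_hits hv hva, ← prod_Ico_one_add_inv hab]
  norm_num

lemma UniformChoices.integral_pow_hits_root_le (hY : UniformChoices P Y) (b : ℕ) {z : ℝ}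
    (hz : 0 ≤ z) :
    ∫ ω, z ^ hits Y (Finset.Ico 0 b) 1 ω ∂P ≤ Real.exp ((z - 1) * harmonic b) := by
  rw [hY.integral_pow_hits le_rfl le_rfl, ← sum_range_inv_eq_harmonic, Finset.mul_sum,
    Real.exp_sum]
  refine Finset.prod_le_prod (fun i _ => ?_) fun i _ => ?_
  · have : 1 + (z - 1) * (1 / ((i : ℝ) + 1)) = (i + z) / (i + 1) := by field_simp; ring
    rw [this]; positivity
  · linarith [Real.add_one_le_exp ((z - 1) * (1 / ((i : ℝ) + 1)))]

/-- Chernoff's bound with base `1 - t`. Replacing `log (1 - t)` by `-t / (1 - t)` keeps the exponent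
rational in `t`. -/
lemma UniformChoices.measureReal_root_le (hY : UniformChoices P Y) (b : ℕ) {t x : ℝ}
    (ht0 : 0 ≤ t) (ht : t < 1) :
    P.real {ω | (hits Y (Finset.Ico 0 b) 1 ω : ℝ) ≤ x} ≤
      Real.exp (x * (t / (1 - t)) - t * Real.log (b + 1)) := by
  have h1 : 0 < 1 - t := by linarith
  refine (measureReal_le_integral_div (integrable_pow_hits hY.measurable (Finset.Ico 0 b) 1 (1 - t))
    (fun ω => by positivity) (Real.exp_pos (-(x * (t / (1 - t))))) (fun ω hω => ?_)).trans ?_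
  · calc Real.exp (-(x * (t / (1 - t))))
        ≤ Real.exp (hits Y (Finset.Ico 0 b) 1 ω * -(t / (1 - t))) := by
          rw [mul_neg]
          gcongr
          exact hω
      _ = Real.exp (-(t / (1 - t))) ^ hits Y (Finset.Ico 0 b) 1 ω := Real.exp_nat_mul _ _
      _ ≤ _ := by gcongr; exact exp_neg_div_le_one_sub ht
  · rw [Real.exp_neg, div_inv_eq_mul, sub_eq_add_neg (x * _), Real.exp_add, mul_comm]
    gcongr
    refine (hY.integral_pow_hits_root_le b h1.le).trans (Real.exp_le_exp.2 ?_)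
    have := log_add_one_le_harmonic b
    push_cast at this
    nlinarith

lemma UniformChoices.measureReal_le_root (hY : UniformChoices P Y) (b : ℕ) {t x : ℝ}
    (ht0 : 0 ≤ t) :
    P.real {ω | x ≤ (hits Y (Finset.Ico 0 b) 1 ω : ℝ)} ≤
      Real.exp (t * (1 + Real.log (b + 1)) - x * (t / (1 + t))) := by
  have h1 : 0 < 1 + t := by linarith
  refine (measureReal_le_integral_div (integrable_pow_hits hY.measurable (Finset.Ico 0 b) 1 (1 + t))
    (fun ω => by positivity) (Real.exp_pos (x * (t / (1 + t)))) (fun ω hω => ?_)).trans ?_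
  · calc Real.exp (x * (t / (1 + t)))
        ≤ Real.exp (hits Y (Finset.Ico 0 b) 1 ω * (t / (1 + t))) := by
          gcongr
          exact hω
      _ = Real.exp (t / (1 + t)) ^ hits Y (Finset.Ico 0 b) 1 ω := Real.exp_nat_mul _ _
      _ ≤ _ := by gcongr; exact exp_div_le_one_add ht0
  · rw [Real.exp_sub]
    gcongr
    refine (hY.integral_pow_hits_root_le b h1.le).trans (Real.exp_le_exp.2 ?_)
    have := harmonic_le_one_add_log b
    have h2 : Real.log b ≤ Real.log (b + 1) := by
      rcases Nat.eq_zero_or_pos b with h | h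
      · simp [h]
      · gcongr; linarith
    nlinarith

lemma UniformChoices.measureReal_le_hits (hY : UniformChoices P Y) {a v : ℕ} (hv : 1 ≤ v)
    (hva : v ≤ a + 1) {b : ℕ} (hab : a ≤ b) (d : ℕ) :
    P.real {ω | d ≤ hits Y (Finset.Ico a b) v ω} ≤ (b + 1) / (a + 1) / 2 ^ d := by
  rw [← hY.integral_two_pow_hits hv hva hab]
  refine measureReal_le_integral_div (integrable_pow_hits hY.measurable _ _ _)
    (fun ω => by positivity) (by positivity) (fun ω hω => ?_)
  exact pow_le_pow_right₀ (by norm_num) hω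

/-- A lower bound for the upper tail of the degree, by exponential tilting. -/
lemma UniformChoices.le_measureReal_hits (hY : UniformChoices P Y) {a v : ℕ} (hv : 1 ≤ v)
    (hva : v ≤ a + 1) {b : ℕ} (hab : a ≤ b) {d e : ℕ} {t : ℝ} (ht0 : 0 ≤ t) (ht : t < 1)
    (hd : d * (t / (1 - t)) + 2 ≤ 2 * t * Real.log ((b + 2) / (a + 2)))
    (he : 2 * t * Real.log ((b + 1) / (a + 1)) + 2 ≤ e * (t / (1 + t))) :
    ((b : ℝ) + 1) / (a + 1) / 2 / 2 ^ e ≤ P.real {ω | d ≤ hits Y (Finset.Ico a b) v ω} := by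
  have h1 : 0 < 1 - t := by linarith
  have h2 : 0 < 1 + t := by linarith
  set X := hits Y (Finset.Ico a b) v
  set S := ∑ i ∈ Finset.Ico a b, 1 / ((i : ℝ) + 2)
  set M : ℝ := ((b : ℝ) + 1) / (a + 1)
  have hM : 0 < M := by positivity
  have hS1 := log_div_le_sum_Ico hab
  have hS2 := sum_Ico_le_log_div hab
  have hint : ∀ z : ℝ, Integrable (fun ω => z ^ X ω) P := fun z =>
    integrable_pow_hits hY.measurable _ _ z
  have hms : MeasurableSet {ω | d ≤ X ω} := measurable_hits hY.measurable _ _ .of_discrete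
  have hMGF : ∀ z : ℝ, 0 ≤ z → ∫ ω, z ^ X ω ∂P ≤ M * Real.exp ((z - 2) * S) := fun z hz => by
    rw [hY.integral_pow_hits hv hva]
    exact prod_Ico_le_exp hab hz
  -- The summands `2` in `hd` and `he` make each outer range cost at most `M * exp (-2)`, so at
  -- least half of `M` is left for the middle range.
  have hexp : Real.exp (-2) ≤ 1 / 4 := by
    have := Real.exp_one_gt_d9
    rw [Real.exp_neg, show (2 : ℝ) = 1 + 1 by norm_num, Real.exp_add]
    rw [inv_le_comm₀ (by positivity) (by norm_num)]
    nlinarith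
  have key : M ≤ 2 ^ e * P.real {ω | d ≤ X ω} +
      (2 / (2 * (1 - t))) ^ d * ∫ ω, (2 * (1 - t)) ^ X ω ∂P +
      (2 / (2 * (1 + t))) ^ e * ∫ ω, (2 * (1 + t)) ^ X ω ∂P := by
    have hi : Integrable ({ω | d ≤ X ω}.indicator (fun _ => (1 : ℝ))) P :=
      (integrable_const _).indicator hms
    have : P.real {ω | d ≤ X ω} = ∫ ω, {ω | d ≤ X ω}.indicator (fun _ => (1 : ℝ)) ω ∂P := by
      rw [integral_indicator_const _ hms]; simp
    rw [this, ← integral_const_mul, ← integral_const_mul, ← integral_const_mul,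
      ← integral_add (hi.const_mul _) ((hint _).const_mul _),
      ← integral_add (f := fun ω => 2 ^ e * {ω | d ≤ X ω}.indicator (fun _ => (1 : ℝ)) ω +
        (2 / (2 * (1 - t))) ^ d * (2 * (1 - t)) ^ X ω)
        ((hi.const_mul _).add ((hint _).const_mul _)) ((hint _).const_mul _),
      ← show ∫ ω, (2 : ℝ) ^ X ω ∂P = M from hY.integral_two_pow_hits hv hva hab]
    refine integral_mono (hint 2)
      (((hi.const_mul _).add ((hint _).const_mul _)).add ((hint _).const_mul _)) fun ω => ?_
    simpa [Set.indicator_apply] using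
      two_pow_le_tilt (y := 2 * (1 - t)) (w := 2 * (1 + t)) (by linarith) (by linarith)
        (by linarith) d e (X ω)
  have b1 : (2 / (2 * (1 - t))) ^ d * ∫ ω, (2 * (1 - t)) ^ X ω ∂P ≤ M * (1 / 4) := by
    have q1 : 2 / (2 * (1 - t)) ≤ Real.exp (t / (1 - t)) := by
      have := exp_neg_div_le_one_sub ht
      rw [Real.exp_neg, inv_le_comm₀ (Real.exp_pos _) h1] at this
      refine le_trans (le_of_eq ?_) this
      field_simp
    calc _ ≤ Real.exp (t / (1 - t)) ^ d * (M * Real.exp ((2 * (1 - t) - 2) * S)) := by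
          gcongr
          exact hMGF _ (by linarith)
      _ = M * Real.exp (d * (t / (1 - t)) + (2 * (1 - t) - 2) * S) := by
          rw [← Real.exp_nat_mul, Real.exp_add]; ring
      _ ≤ M * Real.exp (-2) := by
          gcongr
          nlinarith
      _ ≤ _ := by gcongr
  have b2 : (2 / (2 * (1 + t))) ^ e * ∫ ω, (2 * (1 + t)) ^ X ω ∂P ≤ M * (1 / 4) := by
    have q1 : 2 / (2 * (1 + t)) ≤ Real.exp (-(t / (1 + t))) := by
      have := exp_div_le_one_add ht0
      rw [Real.exp_neg]
      rw [← inv_le_inv₀ h2 (Real.exp_pos _)] at this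
      refine le_trans (le_of_eq ?_) this
      field_simp
    calc _ ≤ Real.exp (-(t / (1 + t))) ^ e * (M * Real.exp ((2 * (1 + t) - 2) * S)) := by
          gcongr
          exact hMGF _ (by linarith)
      _ = M * Real.exp (e * -(t / (1 + t)) + (2 * (1 + t) - 2) * S) := by
          rw [← Real.exp_nat_mul, Real.exp_add]; ring
      _ ≤ M * Real.exp (-2) := by
          gcongr
          nlinarith
      _ ≤ _ := by gcongr
  rw [div_le_iff₀ (by positivity)]
  linarith

end Degrees

/-! ### The number of vertices of high degree at a deterministic level. -/

/-- The number of vertices in `{1, …, b + 1}` chosen at least `d` times among `Y 0, …, Y (b - 1)`. -/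
def hitsTail {Ω : Type*} (Y : ℕ → Ω → ℕ) (b d : ℕ) (ω : Ω) : ℕ :=
  ((Finset.Icc 1 (b + 1)).filter (fun v => d ≤ hits Y (Finset.Ico 0 b) v ω)).card

lemma hitsTail_anti {Ω : Type*} (Y : ℕ → Ω → ℕ) (b : ℕ) (ω : Ω) {d d' : ℕ} (h : d ≤ d') :
    hitsTail Y b d' ω ≤ hitsTail Y b d ω :=
  Finset.card_le_card (Finset.monotone_filter_right _ fun _ _ hv => h.trans hv)

lemma one_le_hitsTail_root {Ω : Type*} (Y : ℕ → Ω → ℕ) (b : ℕ) (ω : Ω) :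
    1 ≤ hitsTail Y b (hits Y (Finset.Ico 0 b) 1 ω) ω :=
  Finset.card_pos.2 ⟨1, by simp⟩

lemma hitsTail_le {Ω : Type*} (Y : ℕ → Ω → ℕ) (b d : ℕ) (ω : Ω) : hitsTail Y b d ω ≤ b + 1 :=
  (Finset.card_filter_le _ _).trans (by simp)

lemma treeDegree_eq_hits {Ω : Type*} {Y : ℕ → Ω → ℕ} {par : ℕ → ℕ} {ω : Ω}
    (h : ∀ i, par (i + 2) = Y i ω) (b v : ℕ) :
    treeDegree par (b + 1) v = hits Y (Finset.Ico 0 b) v ω := by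
  unfold treeDegree hits
  symm
  refine Finset.card_bij (fun i _ => i + 2) ?_ (fun _ _ _ _ h => by omega) ?_
  · intro i hi
    simp only [Finset.mem_filter, Finset.mem_Ico, Finset.mem_Icc] at hi ⊢
    exact ⟨by omega, by rw [h]; exact hi.2⟩
  · intro j hj
    simp only [Finset.mem_filter, Finset.mem_Ico, Finset.mem_Icc] at hj ⊢
    refine ⟨j - 2, ⟨by omega, ?_⟩, by omega⟩
    rw [← h, show j - 2 + 2 = j by omega]
    exact hj.2

lemma tailCount_rootDegree_eq_hitsTail {Ω : Type*} {Y : ℕ → Ω → ℕ} {par : ℕ → ℕ} {ω : Ω}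
    (h : ∀ i, par (i + 2) = Y i ω) (b : ℕ) :
    tailCount par (b + 1) (rootDegree par (b + 1)) =
      hitsTail Y b (hits Y (Finset.Ico 0 b) 1 ω) ω := by
  simp only [tailCount, rootDegree, hitsTail, treeDegree_eq_hits h]

section Tail

variable {Ω : Type*} [MeasurableSpace Ω] {P : Measure Ω} {Y : ℕ → Ω → ℕ}

lemma UniformChoices.measurable_hitsTail_root (hY : UniformChoices P Y) (b : ℕ) :
    Measurable fun ω => hitsTail Y b (hits Y (Finset.Ico 0 b) 1 ω) ω := by
  have : (fun ω => hitsTail Y b (hits Y (Finset.Ico 0 b) 1 ω) ω) = fun ω =>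
      ∑ v ∈ Finset.Icc 1 (b + 1),
        if hits Y (Finset.Ico 0 b) 1 ω ≤ hits Y (Finset.Ico 0 b) v ω then 1 else 0 := by
    ext ω; exact Finset.card_filter _ _
  rw [this]
  refine Finset.measurable_sum _ fun v _ => ?_
  exact Measurable.ite (measurableSet_le (measurable_hits hY.measurable _ _)
    (measurable_hits hY.measurable _ _)) measurable_const measurable_const

/-- Vertex `a + 1` does not exist before step `a`: almost surely `Y i ≤ i + 1 < a + 1` for `i < a`.
-/
lemma UniformChoices.hits_ae_eq (hY : UniformChoices P Y) (a b : ℕ) :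
    ∀ᵐ ω ∂P, hits Y (Finset.Ico 0 b) (a + 1) ω = hits Y (Finset.Ico a b) (a + 1) ω := by
  filter_upwards [ae_all_iff.2 hY.le] with ω hω
  unfold hits
  congr 1
  ext i
  simp only [Finset.mem_filter, Finset.mem_Ico]
  have := hω i
  constructor
  · rintro ⟨h1, h2⟩; exact ⟨by omega, h2⟩
  · rintro ⟨h1, h2⟩; exact ⟨by omega, h2⟩

variable [IsProbabilityMeasure P]

lemma UniformChoices.measureReal_le_hitsTail (hY : UniformChoices P Y) (b d : ℕ) {x : ℝ}
    (hx : 0 < x) :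
    P.real {ω | x ≤ (hitsTail Y b d ω : ℝ)} ≤
      (b + 1) * (1 + Real.log (b + 1)) / 2 ^ d / x := by
  have h1 := measureReal_le_card_filter_le (P := P) (Finset.Icc 1 (b + 1))
    (fun v => {ω | d ≤ hits Y (Finset.Ico 0 b) v ω})
    (fun v _ => measurable_hits hY.measurable _ _ .of_discrete) hx
  have h2 : {ω | x ≤ (hitsTail Y b d ω : ℝ)} = {ω | x ≤ (((Finset.Icc 1 (b + 1)).filter
      (fun v => ω ∈ {ω | d ≤ hits Y (Finset.Ico 0 b) v ω})).card : ℝ)} := by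
    ext ω
    simp only [hitsTail, Set.mem_ofPred_eq]
  rw [h2]
  refine h1.trans ?_
  gcongr
  have h3 : ∀ v ∈ Finset.Icc 1 (b + 1), P.real {ω | d ≤ hits Y (Finset.Ico 0 b) v ω} ≤
      (b + 1) / 2 ^ d * (v : ℝ)⁻¹ := by
    intro v hv
    obtain ⟨a, rfl⟩ := Nat.exists_eq_add_of_le' (Finset.mem_Icc.1 hv).1
    have hab : a ≤ b := by have := (Finset.mem_Icc.1 hv).2; omega
    have h4 : P.real {ω | d ≤ hits Y (Finset.Ico 0 b) (a + 1) ω} =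
        P.real {ω | d ≤ hits Y (Finset.Ico a b) (a + 1) ω} := by
      refine measureReal_congr ?_
      filter_upwards [hY.hits_ae_eq a b] with ω hω
      change (d ≤ _) = (d ≤ _)
      rw [hω]
    rw [h4]
    refine (hY.measureReal_le_hits (by omega) le_rfl hab d).trans (le_of_eq ?_)
    push_cast
    field_simp
  refine (Finset.sum_le_sum h3).trans ?_
  rw [← Finset.mul_sum]
  have h5 := harmonic_le_one_add_log (b + 1)
  rw [harmonic_eq_sum_Icc] at h5
  push_cast at h5
  calc _ ≤ ((b : ℝ) + 1) / 2 ^ d * (1 + Real.log (b + 1)) := by gcongr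
    _ = _ := by ring

/-- Only vertices up to `a + 1` and choices from step `a` on are counted, so one tail bound serves
all these vertices. The factor `a + 1` then cancels and the mean is at least `(b + 1) / (2 * 2 ^
e)`. -/
lemma UniformChoices.measureReal_hitsTail_le (hY : UniformChoices P Y) {a b : ℕ} (hab : a ≤ b)
    {d e : ℕ} {t : ℝ} (ht0 : 0 ≤ t) (ht : t < 1)
    (hd : d * (t / (1 - t)) + 2 ≤ 2 * t * Real.log ((b + 2) / (a + 2)))
    (he : 2 * t * Real.log ((b + 1) / (a + 1)) + 2 ≤ e * (t / (1 + t))) :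
    P.real {ω | (hitsTail Y b d ω : ℝ) ≤ (b + 1) / (4 * 2 ^ e)} ≤ 8 * 2 ^ e / (b + 1) := by
  set A : ℕ → Set Ω := fun v => {ω | d ≤ hits Y (Finset.Ico a b) v ω} with hA
  have hsum : ((b : ℝ) + 1) / (2 * 2 ^ e) ≤ ∑ v ∈ Finset.Icc 1 (a + 1), P.real (A v) := by
    have h1 : ∀ v ∈ Finset.Icc 1 (a + 1), ((b : ℝ) + 1) / (a + 1) / 2 / 2 ^ e ≤ P.real (A v) :=
      fun v hv => hY.le_measureReal_hits (Finset.mem_Icc.1 hv).1 (Finset.mem_Icc.1 hv).2 hab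
        ht0 ht hd he
    refine le_trans (le_of_eq ?_) (Finset.sum_le_sum h1)
    simp only [Finset.sum_const, Nat.card_Icc, nsmul_eq_mul]
    push_cast
    field_simp
  have hpos : 0 < ∑ v ∈ Finset.Icc 1 (a + 1), P.real (A v) := lt_of_lt_of_le (by positivity) hsum
  have h2 := measureReal_card_filter_le_half (P := P) (Finset.Icc 1 (a + 1)) A
    (fun v _ => measurable_hits hY.measurable _ _ .of_discrete)
    (fun u _ v _ huv => measureReal_hits_and_le hY.measurable hY.indep huv _ d d) hpos
  calc P.real {ω | (hitsTail Y b d ω : ℝ) ≤ (b + 1) / (4 * 2 ^ e)}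
      ≤ P.real {ω | (((Finset.Icc 1 (a + 1)).filter (fun v => ω ∈ A v)).card : ℝ) ≤
          (∑ v ∈ Finset.Icc 1 (a + 1), P.real (A v)) / 2} := by
        refine measureReal_mono fun ω hω => ?_
        simp only [Set.mem_ofPred_eq] at hω ⊢
        have h3 : ((Finset.Icc 1 (a + 1)).filter (fun v => ω ∈ A v)).card ≤ hitsTail Y b d ω := by
          refine Finset.card_le_card fun v hv => ?_
          simp only [Finset.mem_filter, Finset.mem_Icc, hA, Set.mem_ofPred_eq] at hv ⊢
          refine ⟨by omega, hv.2.trans (Finset.card_le_card (Finset.filter_subset_filter _ ?_))⟩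
          exact Finset.Ico_subset_Ico_left (Nat.zero_le _)
        have h4 : (((Finset.Icc 1 (a + 1)).filter (fun v => ω ∈ A v)).card : ℝ) ≤
            hitsTail Y b d ω := by exact_mod_cast h3
        have h5 : ((b : ℝ) + 1) / (4 * 2 ^ e) = (b + 1) / (2 * 2 ^ e) / 2 := by
          field_simp; norm_num
        linarith
    _ ≤ 4 / ∑ v ∈ Finset.Icc 1 (a + 1), P.real (A v) := h2
    _ ≤ 4 / (((b : ℝ) + 1) / (2 * 2 ^ e)) := by gcongr
    _ = _ := by field_simp; norm_num

end Tail

/-! ### Choice of parameters and concentration of `log Z_{≥ D}`. -/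

section Asymptotics

lemma tendsto_log_succ : Tendsto (fun b : ℕ => Real.log ((b : ℝ) + 1)) atTop atTop :=
  Real.tendsto_log_atTop.comp (tendsto_atTop_add_const_right _ _ tendsto_natCast_atTop_atTop)

/-- With `a + 1 = ⌈N ^ (1/2 - 2ε)⌉`, the tilted mean is about `(1 + 4ε)L`, strictly between the two
levels. The gaps have order `ε ^ 2 * L` after multiplication by `ε`, and `hb` lets them absorb the
additive constants. -/
lemma exists_split {ε : ℝ} (h0 : 0 < ε) (h1 : ε ≤ 1 / 100) {b : ℕ}
    (hb : (3 : ℝ) ≤ ε ^ 2 * Real.log (b + 1)) :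
    ∃ a ≤ b,
      (⌊(1 + ε) * Real.log (b + 1)⌋₊ : ℝ) * (ε / (1 - ε)) + 2 ≤
        2 * ε * Real.log ((b + 2) / (a + 2)) ∧
      2 * ε * Real.log ((b + 1) / (a + 1)) + 2 ≤
        (⌈(1 + 7 * ε) * Real.log (b + 1)⌉₊ : ℝ) * (ε / (1 + ε)) := by
  set N : ℝ := (b : ℝ) + 1 with hN
  have hN1 : 1 ≤ N := by rw [hN]; linarith [Nat.cast_nonneg (α := ℝ) b]
  have hN0 : 0 < N := by linarith
  set L := Real.log N with hL
  have hL0 : 0 ≤ L := Real.log_nonneg hN1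
  set x : ℝ := N ^ (1 / 2 - 2 * ε) with hx
  have hx1 : 1 ≤ x := Real.one_le_rpow hN1 (by linarith)
  have hxN : x ≤ N := by
    calc x ≤ N ^ (1 : ℝ) := Real.rpow_le_rpow_of_exponent_le hN1 (by linarith)
      _ = N := Real.rpow_one _
  have hlx : Real.log x = (1 / 2 - 2 * ε) * L := Real.log_rpow hN0 _
  have hc1 : 1 ≤ ⌈x⌉₊ := Nat.one_le_ceil_iff.2 (by linarith)
  have hcast : ((⌈x⌉₊ - 1 : ℕ) : ℝ) = ⌈x⌉₊ - 1 := by push_cast [hc1]; ring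
  have hle := Nat.le_ceil x
  have hlt := Nat.ceil_lt_add_one (show 0 ≤ x by linarith)
  have hlog3 : Real.log 3 ≤ 2 := by
    have := Real.log_le_sub_one_of_pos (show (0 : ℝ) < 3 by norm_num)
    linarith
  refine ⟨⌈x⌉₊ - 1, ?_, ?_, ?_⟩
  · have : ⌈x⌉₊ ≤ b + 1 := Nat.ceil_le.2 (by push_cast; exact hxN)
    omega
  · have h2 : (1 / 2 + 2 * ε) * L - 2 ≤ Real.log ((b + 2) / ((⌈x⌉₊ - 1 : ℕ) + 2)) := by
      rw [hcast]
      have : Real.log (N / (3 * x)) ≤ Real.log ((b + 2) / (⌈x⌉₊ - 1 + 2)) := by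
        refine Real.log_le_log (by positivity) ?_
        -- The denominator is `⌈x⌉ + 1 ≤ x + 2 ≤ 3 * x`, as `x ≥ 1`.
        gcongr <;> linarith
      rw [Real.log_div (by positivity) (by positivity), Real.log_mul (by norm_num) (by positivity),
        hlx] at this
      linarith
    have h3 : (⌊(1 + ε) * L⌋₊ : ℝ) ≤ (1 + ε) * L := Nat.floor_le (by positivity)
    have h4 : ε / (1 - ε) * (1 + ε) ≤ ε * (1 + 3 * ε) := by
      rw [div_mul_eq_mul_div, div_le_iff₀ (by linarith)]
      nlinarith [mul_pos h0 h0, mul_pos (mul_pos h0 h0) h0]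
    have h5 : 0 ≤ ε / (1 - ε) := div_nonneg h0.le (by linarith)
    calc (⌊(1 + ε) * L⌋₊ : ℝ) * (ε / (1 - ε)) + 2
        ≤ (1 + ε) * L * (ε / (1 - ε)) + 2 := by gcongr
      _ = ε / (1 - ε) * (1 + ε) * L + 2 := by ring
      _ ≤ ε * (1 + 3 * ε) * L + 2 := by gcongr
      _ ≤ 2 * ε * ((1 / 2 + 2 * ε) * L - 2) := by nlinarith
      _ ≤ _ := by gcongr
  · have h2 : Real.log (N / ((⌈x⌉₊ - 1 : ℕ) + 1)) ≤ (1 / 2 + 2 * ε) * L := by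
      rw [hcast, sub_add_cancel]
      have : Real.log (N / ⌈x⌉₊) ≤ Real.log (N / x) :=
        Real.log_le_log (by positivity) (by gcongr)
      rw [Real.log_div (by positivity) (by positivity) (y := x), hlx] at this
      linarith
    have h3 : (1 + 7 * ε) * L ≤ (⌈(1 + 7 * ε) * L⌉₊ : ℝ) := Nat.le_ceil _
    have h4 : ε * (1 + 4 * ε) + ε ^ 2 * (2 / 3) ≤ (1 + 7 * ε) * (ε / (1 + ε)) := by
      rw [mul_div_assoc' (1 + 7 * ε), le_div_iff₀ (by linarith)]
      nlinarith [mul_pos h0 h0, mul_pos (mul_pos h0 h0) h0]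
    calc 2 * ε * Real.log (N / ((⌈x⌉₊ - 1 : ℕ) + 1)) + 2
        ≤ 2 * ε * ((1 / 2 + 2 * ε) * L) + 2 := by gcongr
      _ ≤ (ε * (1 + 4 * ε) + ε ^ 2 * (2 / 3)) * L := by nlinarith
      _ ≤ (1 + 7 * ε) * (ε / (1 + ε)) * L := by gcongr
      _ = (1 + 7 * ε) * L * (ε / (1 + ε)) := by ring
      _ ≤ _ := by gcongr

variable {Ω : Type*} [MeasurableSpace Ω] {P : Measure Ω} [IsProbabilityMeasure P]
  {Y : ℕ → Ω → ℕ}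

-- The four error terms bound the events that `D` is too small, `D` is too large, the count at the
-- lower level is too large, and the count at the upper level is too small. Off these events
-- monotonicity in the level gives the estimate.
set_option maxHeartbeats 1000000 in
lemma UniformChoices.measureReal_log_hitsTail_root (hY : UniformChoices P Y) {ε : ℝ} (h0 : 0 < ε)
    (h1 : ε ≤ 1 / 100) {b : ℕ} (hb : (3 : ℝ) ≤ ε ^ 2 * Real.log (b + 1)) :
    P.real {ω | 7 * ε * Real.log (b + 1) <
        |Real.log (hitsTail Y b (hits Y (Finset.Ico 0 b) 1 ω) ω) -
          (1 - Real.log 2) * Real.log (b + 1)|} ≤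
      Real.exp (-(ε ^ 2 / 4 * Real.log (b + 1))) + Real.exp (1 - ε ^ 2 / 8 * Real.log (b + 1)) +
      (1 + Real.log (b + 1)) * Real.exp (-(ε * Real.log (b + 1))) +
      16 * Real.exp (-(1 / 5 * Real.log (b + 1))) := by
  obtain ⟨a, hab, hd, he⟩ := exists_split h0 h1 hb
  set N : ℝ := (b : ℝ) + 1 with hN
  have hN1 : 1 ≤ N := by rw [hN]; linarith [Nat.cast_nonneg (α := ℝ) b]
  have hN0 : 0 < N := by linarith
  set L := Real.log N with hL
  have hL0 : 0 ≤ L := Real.log_nonneg hN1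
  have hεL : 0 ≤ ε * L := mul_nonneg h0.le hL0
  have hNL : N = Real.exp L := (Real.exp_log hN0).symm
  have hl2 := Real.log_two_gt_d9
  have hl2' := Real.log_two_lt_d9
  set l := Real.log 2 with hl
  set d₁ := ⌈(1 - ε) * L⌉₊ with hd₁
  set d₂ := ⌊(1 + ε) * L⌋₊ with hd₂
  set e := ⌈(1 + 7 * ε) * L⌉₊ with he'
  have hpow : ∀ j : ℕ, (2 : ℝ) ^ j = Real.exp (j * l) := fun j => by
    rw [Real.exp_nat_mul, hl, Real.exp_log (by norm_num)]
  have he2 : (2 : ℝ) ^ e ≤ 2 * Real.exp ((1 + 7 * ε) * L * l) := by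
    have : (e : ℝ) ≤ (1 + 7 * ε) * L + 1 := (Nat.ceil_lt_add_one (by positivity)).le
    calc (2 : ℝ) ^ e = Real.exp (e * l) := hpow e
      _ ≤ Real.exp (((1 + 7 * ε) * L + 1) * l) := by gcongr
      _ = Real.exp l * Real.exp ((1 + 7 * ε) * L * l) := by rw [← Real.exp_add]; congr 1; ring
      _ = _ := by rw [hl, Real.exp_log (by norm_num)]
  set B₁ := {ω | (hits Y (Finset.Ico 0 b) 1 ω : ℝ) ≤ (1 - ε) * L}
  set B₂ := {ω | (1 + ε) * L ≤ (hits Y (Finset.Ico 0 b) 1 ω : ℝ)}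
  set B₃ := {ω | Real.exp ((1 - l + 2 * ε) * L) ≤ (hitsTail Y b d₁ ω : ℝ)}
  set B₄ := {ω | (hitsTail Y b d₂ ω : ℝ) ≤ N / (4 * 2 ^ e)}
  have p₁ : P.real B₁ ≤ Real.exp (-(ε ^ 2 / 4 * L)) := by
    refine (hY.measureReal_root_le b (t := ε / 2) (by linarith) (by linarith)).trans
      (Real.exp_le_exp.2 ?_)
    rw [← hN, ← hL]
    have : (1 - ε) * (ε / 2 / (1 - ε / 2)) ≤ ε / 2 - ε ^ 2 / 4 := by
      rw [mul_div_assoc', div_le_iff₀ (by linarith)]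
      nlinarith [mul_pos h0 h0, mul_pos (mul_pos h0 h0) h0]
    nlinarith
  have p₂ : P.real B₂ ≤ Real.exp (1 - ε ^ 2 / 8 * L) := by
    refine (hY.measureReal_le_root b (t := ε / 2) (by linarith)).trans (Real.exp_le_exp.2 ?_)
    rw [← hN, ← hL]
    have : ε / 2 + ε ^ 2 / 8 ≤ (1 + ε) * (ε / 2 / (1 + ε / 2)) := by
      rw [mul_div_assoc', le_div_iff₀ (by linarith)]
      nlinarith [mul_pos h0 h0, mul_pos (mul_pos h0 h0) h0]
    nlinarith
  have p₃ : P.real B₃ ≤ (1 + L) * Real.exp (-(ε * L)) := by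
    refine (hY.measureReal_le_hitsTail b d₁ (Real.exp_pos _)).trans ?_
    rw [← hN, ← hL, hpow, div_div, ← Real.exp_add]
    have h2 : (1 - ε) * L * l ≤ d₁ * l := by gcongr; exact Nat.le_ceil _
    rw [div_eq_mul_inv, ← Real.exp_neg, mul_comm N, mul_assoc]
    gcongr
    rw [hNL, ← Real.exp_add]
    gcongr
    -- The exponent is at most `L - (1 - ε)Ll - (1 - l + 2ε)L = -(2 - l)εL`.
    linarith [mul_nonneg hεL (show 0 ≤ 1 - l by linarith)]
  have p₄ : P.real B₄ ≤ 16 * Real.exp (-(1 / 5 * L)) := by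
    refine (hY.measureReal_hitsTail_le hab h0.le (by linarith) hd he).trans ?_
    rw [← hN, div_le_iff₀ hN0, hNL, mul_assoc, ← Real.exp_add]
    have h2 : Real.exp ((1 + 7 * ε) * L * l) ≤ Real.exp (-(1 / 5 * L) + L) := by
      gcongr
      -- The cap `ε ≤ 1/100` keeps `2 ^ e` below a power of `N` with exponent less than `1`.
      have : (1 + 7 * ε) * l ≤ 4 / 5 := by nlinarith
      nlinarith
    linarith
  have hsub : {ω | 7 * ε * L < |Real.log (hitsTail Y b (hits Y (Finset.Ico 0 b) 1 ω) ω) -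
      (1 - l) * L|} ⊆ B₁ ∪ B₂ ∪ B₃ ∪ B₄ := by
    intro ω hω
    by_contra hcon
    simp only [Set.mem_union, not_or] at hcon
    obtain ⟨⟨⟨n₁, n₂⟩, n₃⟩, n₄⟩ := hcon
    simp only [B₁, B₂, B₃, B₄, Set.mem_ofPred_eq, not_le] at n₁ n₂ n₃ n₄ hω
    set D := hits Y (Finset.Ico 0 b) 1 ω
    have m₁ : hitsTail Y b D ω ≤ hitsTail Y b d₁ ω :=
      hitsTail_anti Y b ω (Nat.ceil_le.2 n₁.le)
    have m₂ : hitsTail Y b d₂ ω ≤ hitsTail Y b D ω :=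
      hitsTail_anti Y b ω (Nat.le_floor n₂.le)
    have hZ1 : (1 : ℝ) ≤ hitsTail Y b D ω := by exact_mod_cast one_le_hitsTail_root Y b ω
    have u₁ : Real.log (hitsTail Y b D ω) ≤ (1 - l + 2 * ε) * L := by
      rw [Real.log_le_iff_le_exp (by linarith)]
      have : (hitsTail Y b D ω : ℝ) ≤ hitsTail Y b d₁ ω := by exact_mod_cast m₁
      linarith
    have u₂ : (1 - l - 7 * ε) * L ≤ Real.log (hitsTail Y b D ω) := by
      rw [Real.le_log_iff_exp_le (by linarith)]
      have h2 : (hitsTail Y b d₂ ω : ℝ) ≤ hitsTail Y b D ω := by exact_mod_cast m₂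
      refine le_trans ?_ (n₄.le.trans h2)
      rw [le_div_iff₀ (by positivity)]
      -- The constant `4 * 2` is paid for with `2εL`, which fits because `7 * log 2 ≤ 5`.
      have h8 : (8 : ℝ) ≤ Real.exp (2 * ε * L) := by
        have h9 : (6 : ℝ) ≤ 2 * ε * L * (1 / 100) := by nlinarith
        have := Real.add_one_le_exp (2 * ε * L)
        linarith
      calc Real.exp ((1 - l - 7 * ε) * L) * (4 * 2 ^ e)
          ≤ Real.exp ((1 - l - 7 * ε) * L) * (4 * (2 * Real.exp ((1 + 7 * ε) * L * l))) := by
            gcongr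
        _ = 8 * (Real.exp ((1 - l - 7 * ε) * L) * Real.exp ((1 + 7 * ε) * L * l)) := by ring
        _ ≤ Real.exp (2 * ε * L) *
            (Real.exp ((1 - l - 7 * ε) * L) * Real.exp ((1 + 7 * ε) * L * l)) := by gcongr
        _ = Real.exp (2 * ε * L + ((1 - l - 7 * ε) * L + (1 + 7 * ε) * L * l)) := by
            rw [Real.exp_add, Real.exp_add]
        _ ≤ Real.exp L := by
            gcongr
            linarith [mul_nonneg hεL (show 0 ≤ 5 - 7 * l by linarith)]
        _ = N := hNL.symm
    have : |Real.log (hitsTail Y b D ω) - (1 - l) * L| ≤ 7 * ε * L := by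
      rw [abs_le]
      constructor <;> linarith
    linarith
  have q1 := measureReal_mono (μ := P) hsub
  have q2 := measureReal_union_le (μ := P) (B₁ ∪ B₂ ∪ B₃) B₄
  have q3 := measureReal_union_le (μ := P) (B₁ ∪ B₂) B₃
  have q4 := measureReal_union_le (μ := P) B₁ B₂
  linarith

end Asymptotics

/-! ### From convergence in probability to moments. -/

section Limit

variable {Ω : Type*} [MeasurableSpace Ω] {P : Measure Ω} [IsProbabilityMeasure P]
  {Y : ℕ → Ω → ℕ}

lemma UniformChoices.tendsto_measureReal_log_hitsTail_root (hY : UniformChoices P Y) {ε : ℝ}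
    (h0 : 0 < ε) (h1 : ε ≤ 1 / 100) :
    Tendsto (fun b : ℕ => P.real {ω | 7 * ε * Real.log (b + 1) <
        |Real.log (hitsTail Y b (hits Y (Finset.Ico 0 b) 1 ω) ω) -
          (1 - Real.log 2) * Real.log (b + 1)|}) atTop (nhds 0) := by
  have hneg : ∀ c : ℝ, 0 < c → Tendsto (fun x : ℝ => Real.exp (-(c * x))) atTop (nhds 0) :=
    fun c hc => Real.tendsto_exp_neg_atTop_nhds_zero.comp (tendsto_id.const_mul_atTop hc)
  have hlin : Tendsto (fun x : ℝ => (1 + x) * Real.exp (-(ε * x))) atTop (nhds 0) := by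
    have h2 := (Real.tendsto_pow_mul_exp_neg_atTop_nhds_zero 1).comp
      (tendsto_id.const_mul_atTop h0)
    have h3 := (hneg ε h0).add (h2.const_mul ε⁻¹)
    simp only [mul_zero, add_zero] at h3
    refine h3.congr fun x => ?_
    simp only [Function.comp, id, pow_one]
    field_simp
  have hlim : Tendsto (fun x : ℝ => Real.exp (-(ε ^ 2 / 4 * x)) + Real.exp (1 - ε ^ 2 / 8 * x) +
      (1 + x) * Real.exp (-(ε * x)) + 16 * Real.exp (-(1 / 5 * x))) atTop (nhds 0) := by
    have h2 := (hneg (ε ^ 2 / 8) (by positivity)).const_mul (Real.exp 1)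
    have h3 := (((hneg (ε ^ 2 / 4) (by positivity)).add h2).add hlin).add
      ((hneg (1 / 5) (by norm_num)).const_mul 16)
    simp only [mul_zero, add_zero] at h3
    refine h3.congr fun x => ?_
    rw [sub_eq_add_neg, Real.exp_add 1]
  refine squeeze_zero' (Eventually.of_forall fun b => measureReal_nonneg) ?_
    (hlim.comp tendsto_log_succ)
  filter_upwards [(tendsto_log_succ.const_mul_atTop (show 0 < ε ^ 2 by positivity)).eventually_ge_atTop
    3] with b hb
  exact hY.measureReal_log_hitsTail_root h0 h1 hb

/-- Convergence in probability of uniformly bounded variables implies convergence of moments. -/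
lemma tendsto_integral_pow_of_tendsto_measureReal {R : ℕ → Ω → ℝ} {c : ℝ}
    (hR : ∀ n, Measurable (R n)) (h0 : ∀ n ω, 0 ≤ R n ω) (h1 : ∀ n ω, R n ω ≤ 1)
    (hc0 : 0 ≤ c) (hc1 : c ≤ 1)
    (h : ∀ δ, 0 < δ → Tendsto (fun n => P.real {ω | δ < |R n ω - c|}) atTop (nhds 0)) (k : ℕ) :
    Tendsto (fun n => ∫ ω, R n ω ^ k ∂P) atTop (nhds (c ^ k)) := by
  have hint : ∀ n, Integrable (fun ω => R n ω ^ k) P := fun n =>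
    Integrable.of_bound (C := 1) ((hR n).pow_const k).aestronglyMeasurable
      (ae_of_all _ fun ω => by
        rw [Real.norm_eq_abs, abs_of_nonneg (pow_nonneg (h0 n ω) k)]
        exact pow_le_one₀ (h0 n ω) (h1 n ω))
  have hbound : ∀ δ, 0 < δ → ∀ n, |∫ ω, R n ω ^ k ∂P - c ^ k| ≤
      k * (δ + P.real {ω | δ < |R n ω - c|}) := by
    intro δ hδ n
    have hms : MeasurableSet {ω | δ < |R n ω - c|} := by
      have : Measurable fun ω => |R n ω - c| := by
        have := hR n
        fun_prop
      exact measurableSet_lt measurable_const this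
    have hsub : ∫ ω, R n ω ^ k ∂P - c ^ k = ∫ ω, (R n ω ^ k - c ^ k) ∂P := by
      rw [integral_sub (hint n) (integrable_const _)]
      simp
    have hi : Integrable ({ω | δ < |R n ω - c|}.indicator (fun _ => (1 : ℝ))) P :=
      (integrable_const _).indicator hms
    rw [hsub]
    refine (abs_integral_le_integral_abs).trans ?_
    have hpt : ∀ ω, |R n ω ^ k - c ^ k| ≤
        k * (δ + {ω | δ < |R n ω - c|}.indicator (fun _ => (1 : ℝ)) ω) := by
      intro ω
      have h2 : |R n ω ^ k - c ^ k| ≤ |R n ω - c| * k := by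
        refine (abs_pow_sub_pow_le _ _ k).trans ?_
        refine mul_le_of_le_one_right (by positivity) (pow_le_one₀ (by positivity) ?_)
        rw [abs_of_nonneg (h0 n ω), abs_of_nonneg hc0]
        exact max_le (h1 n ω) hc1
      rw [mul_comm] at h2
      refine h2.trans ?_
      gcongr
      by_cases hω : δ < |R n ω - c|
      · have : |R n ω - c| ≤ 1 := abs_le.2 ⟨by linarith [h0 n ω], by linarith [h1 n ω]⟩
        rw [Set.indicator_of_mem (show ω ∈ {ω | δ < |R n ω - c|} from hω)]
        linarith
      · rw [Set.indicator_of_notMem (show ω ∉ {ω | δ < |R n ω - c|} from hω)]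
        linarith
    refine (integral_mono ((hint n).sub (integrable_const _)).abs
      (((integrable_const δ).add hi).const_mul (k : ℝ)) hpt).trans (le_of_eq ?_)
    rw [integral_const_mul, integral_add' (integrable_const _) hi, integral_indicator_const _ hms]
    simp
  rw [tendsto_iff_norm_sub_tendsto_zero, Metric.tendsto_atTop]
  intro η hη
  have hk : (0 : ℝ) < k + 1 := by positivity
  obtain ⟨n₀, hn₀⟩ := Metric.tendsto_atTop.1 (h (η / (2 * (k + 1))) (by positivity))
    (η / (2 * (k + 1))) (by positivity)
  refine ⟨n₀, fun n hn => ?_⟩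
  have h2 := hn₀ n hn
  rw [Real.dist_eq, sub_zero, abs_of_nonneg measureReal_nonneg] at h2
  rw [Real.dist_eq, sub_zero, abs_norm, Real.norm_eq_abs]
  refine (hbound (η / (2 * (k + 1))) (by positivity) n).trans_lt ?_
  calc (k : ℝ) * (η / (2 * (k + 1)) + P.real {ω | η / (2 * (k + 1)) < |R n ω - c|})
      ≤ k * (η / (2 * (k + 1)) + η / (2 * (k + 1))) := by gcongr
    _ = k / (k + 1) * η := by field_simp; ring
    _ < η := mul_lt_of_lt_one_left hη ((div_lt_one hk).2 (by linarith))

lemma UniformChoices.integrable_log_hitsTail_root_pow (hY : UniformChoices P Y) (b k : ℕ) :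
    Integrable (fun ω => Real.log (hitsTail Y b (hits Y (Finset.Ico 0 b) 1 ω) ω) ^ k) P := by
  refine Integrable.of_bound (C := Real.log (b + 1) ^ k)
    (((measurable_of_countable (fun x : ℕ => Real.log x ^ k))).comp
      (hY.measurable_hitsTail_root b)).aestronglyMeasurable (ae_of_all _ fun ω => ?_)
  have h1 : (1 : ℝ) ≤ hitsTail Y b (hits Y (Finset.Ico 0 b) 1 ω) ω := by
    exact_mod_cast one_le_hitsTail_root Y b ω
  have h2 : (hitsTail Y b (hits Y (Finset.Ico 0 b) 1 ω) ω : ℝ) ≤ b + 1 := by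
    exact_mod_cast hitsTail_le Y b _ ω
  rw [Real.norm_eq_abs, abs_of_nonneg (pow_nonneg (Real.log_nonneg h1) k)]
  have := Real.log_nonneg h1
  gcongr

lemma UniformChoices.isEquivalent_integral_log_hitsTail_root_pow (hY : UniformChoices P Y)
    (k : ℕ) :
    (fun b : ℕ => ∫ ω, Real.log (hitsTail Y b (hits Y (Finset.Ico 0 b) 1 ω) ω) ^ k ∂P)
      ~[atTop] fun b : ℕ => ((1 - Real.log 2) * Real.log (b + 1)) ^ k := by
  have hl2 := Real.log_two_gt_d9
  have hl2' := Real.log_two_lt_d9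
  let R : ℕ → Ω → ℝ := fun b ω =>
    Real.log (hitsTail Y b (hits Y (Finset.Ico 0 b) 1 ω) ω) / Real.log (b + 1)
  have hLb : ∀ b : ℕ, 0 ≤ Real.log ((b : ℝ) + 1) := fun b =>
    Real.log_nonneg (by linarith [Nat.cast_nonneg (α := ℝ) b])
  have h1 : ∀ b ω, (1 : ℝ) ≤ hitsTail Y b (hits Y (Finset.Ico 0 b) 1 ω) ω := fun b ω => by
    exact_mod_cast one_le_hitsTail_root Y b ω
  have hlim : Tendsto (fun b => ∫ ω, R b ω ^ k ∂P) atTop (nhds ((1 - Real.log 2) ^ k)) := by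
    refine tendsto_integral_pow_of_tendsto_measureReal (fun b => ?_)
      (fun b ω => div_nonneg (Real.log_nonneg (h1 b ω)) (hLb b))
      (fun b ω => div_le_one_of_le₀ ?_ (hLb b)) (by linarith) (by linarith) (fun δ hδ => ?_) k
    · exact ((measurable_of_countable (fun x : ℕ => Real.log x)).comp
        (hY.measurable_hitsTail_root b)).div_const _
    · have h2 : (hitsTail Y b (hits Y (Finset.Ico 0 b) 1 ω) ω : ℝ) ≤ b + 1 := by
        exact_mod_cast hitsTail_le Y b _ ω
      exact Real.log_le_log (by linarith [h1 b ω]) h2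
    · have hε0 : 0 < min (δ / 7) (1 / 100) := by positivity
      refine squeeze_zero' (Eventually.of_forall fun b => measureReal_nonneg) ?_
        (hY.tendsto_measureReal_log_hitsTail_root hε0 (min_le_right _ _))
      filter_upwards [tendsto_log_succ.eventually_gt_atTop 0] with b hb
      refine measureReal_mono fun ω hω => ?_
      simp only [Set.mem_ofPred_eq] at hω ⊢
      rw [div_sub' hb.ne', abs_div, abs_of_pos hb, lt_div_iff₀ hb, mul_comm (Real.log _)
        (1 - _)] at hω
      refine lt_of_le_of_lt ?_ hω
      gcongr
      linarith [min_le_left (δ / 7) (1 / 100)]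
  have h2 : (fun b => ∫ ω, R b ω ^ k ∂P) ~[atTop] fun _ => (1 - Real.log 2) ^ k :=
    -- Equivalence to a constant needs a nonzero limit: `log 2 < 1`.
    (isEquivalent_const_iff_tendsto (pow_ne_zero k (by linarith))).2 hlim
  have h3 := h2.mul (IsEquivalent.refl (u := fun b : ℕ => Real.log ((b : ℝ) + 1) ^ k))
  refine (h3.congr_left ?_).congr_right ?_
  · filter_upwards [tendsto_log_succ.eventually_gt_atTop 0] with b hb
    simp only [Pi.mul_apply, R, div_pow]
    rw [integral_div, div_mul_cancel₀ _ (pow_ne_zero k hb.ne')]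
  · exact Eventually.of_forall fun b => (mul_pow _ _ _).symm

end Limit

/-! ### Transfer to the random recursive tree. -/

/-- The choices in a random recursive tree, up to a modification on a null set. -/
lemma IsRandomRecursiveTree.exists_uniformChoices {Ω : Type*} [MeasurableSpace Ω] {P : Measure Ω}
    {parent : ℕ → Ω → ℕ} (hT : IsRandomRecursiveTree P parent) :
    ∃ Y : ℕ → Ω → ℕ, UniformChoices P Y ∧ ∀ᵐ ω ∂P, ∀ i, parent (i + 2) ω = Y i ω := by
  have hm : ∀ i, AEMeasurable (parent (i + 2)) P := fun i => (hT.uniform (i + 2) (by omega)).1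
  refine ⟨fun i => (hm i).mk, ⟨fun i => (hm i).measurable_mk, ?_, ?_, ?_⟩,
    ae_all_iff.2 fun i => (hm i).ae_eq_mk⟩
  · have h := hT.indep.precomp (g := fun i : ℕ => (⟨i + 2, by omega⟩ : {i : ℕ // 2 ≤ i}))
      (fun i j hij => by simpa using hij)
    exact h.congr fun i => (hm i).ae_eq_mk
  · intro i v hv hvi
    have h1 : P.real {ω | (hm i).mk _ ω = v} = P.real {ω | parent (i + 2) ω = v} := by
      refine measureReal_congr ?_
      filter_upwards [(hm i).ae_eq_mk] with ω hω
      change (_ = v) = (_ = v)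
      rw [hω]
    have h2 := (hT.uniform (i + 2) (by omega)).measure_eq (p := fun x => x = v) .of_discrete
    have h3 : uniformOn (Set.Icc 1 (i + 2 - 1)) {x | x = v} = 1 / ((i + 1 : ℕ) : ENNReal) := by
      have h4 := uniformOn_apply_finset (s := Finset.Icc 1 (i + 1)) (t := {v})
      have h5 : Finset.Icc 1 (i + 1) ∩ {v} = {v} := by
        rw [Finset.inter_singleton_of_mem (Finset.mem_Icc.2 ⟨hv, hvi⟩)]
      rw [h5] at h4
      simpa using h4
    rw [h1, Measure.real, h2, h3, ENNReal.toReal_div, ENNReal.toReal_one, ENNReal.toReal_natCast]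
    push_cast
    rfl
  · intro i
    have h1 : ∀ᵐ ω ∂P, parent (i + 2) ω ≤ i + 1 := by
      rw [ae_iff, (hT.uniform (i + 2) (by omega)).measure_eq (p := fun x => ¬ x ≤ i + 1)
        .of_discrete, ← uniformOn_inter_self (Set.finite_Icc _ _)]
      have : Set.Icc 1 (i + 2 - 1) ∩ {x | ¬ x ≤ i + 1} = ∅ := by
        ext x
        simp only [Set.mem_inter_iff, Set.mem_Icc, Set.mem_ofPred_eq, Set.mem_empty_iff_false,
          iff_false, not_and, and_imp, not_not]
        omega
      rw [this, measure_empty]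
    filter_upwards [h1, (hm i).ae_eq_mk] with ω h2 h3
    rwa [← h3]

theorem theorem1p3 {Ω : Type*} [MeasurableSpace Ω] (P : Measure Ω) [IsProbabilityMeasure P]
    (parent : ℕ → Ω → ℕ) (hT : IsRandomRecursiveTree P parent) (k : ℕ) (hk : 0 < k) :
    (∀ n : ℕ, Integrable (fun ω => Real.log
        (tailCount (fun i => parent i ω) n (rootDegree (fun i => parent i ω) n)) ^ k) P) ∧
    (fun n : ℕ => ∫ ω, Real.log
        (tailCount (fun i => parent i ω) n (rootDegree (fun i => parent i ω) n)) ^ k ∂P)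
      ~[atTop] (fun n : ℕ => ((1 - Real.log 2) * Real.log n) ^ k) := by
  obtain ⟨Y, hY, hae⟩ := hT.exists_uniformChoices
  have hEq : ∀ b : ℕ, (fun ω => Real.log (tailCount (fun i => parent i ω) (b + 1)
      (rootDegree (fun i => parent i ω) (b + 1))) ^ k) =ᵐ[P]
      fun ω => Real.log (hitsTail Y b (hits Y (Finset.Ico 0 b) 1 ω) ω) ^ k := fun b => by
    filter_upwards [hae] with ω hω
    rw [tailCount_rootDegree_eq_hitsTail (par := fun i => parent i ω) hω]
  refine ⟨fun n => ?_, ?_⟩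
  · cases n with
    -- There are no vertices, and `Real.log 0 = 0`, so the integrand is constant.
    | zero => simp [tailCount]
    | succ b => exact (hY.integrable_log_hitsTail_root_pow b k).congr (hEq b).symm
  · have h1 := (hY.isEquivalent_integral_log_hitsTail_root_pow k).comp_tendsto
      (tendsto_sub_atTop_nat 1)
    refine (h1.congr_left ?_).congr_right ?_
    · filter_upwards [eventually_ge_atTop 1] with n hn
      obtain ⟨b, rfl⟩ := Nat.exists_eq_add_of_le' hn
      exact (integral_congr_ae (hEq b)).symm
    · filter_upwards [eventually_ge_atTop 1] with n hn
      obtain ⟨b, rfl⟩ := Nat.exists_eq_add_of_le' hn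
      simp
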